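/- Let $F$ be a finite field with $q$ elements, let $\chi:F\to\mathbb C^{\times}$ be a nontrivial additive character (for $q$ prime one may take $\chi(j)=e^{2\pi i j/q}$), and let $n=2k+1\ge 5$ be odd. A (not necessarily normalized) state of $n$ qudits of local dimension $q$ is a vector in $(\mathbb C^{q})^{\otimes n}$, with computational basis $|v_1,\dots,v_n\rangle$, $v_i\in F$. Let $X^{a}|j\rangle=|j+a\rangle$ and $Z^{a}|j\rangle=\chi(aj)|j\rangle$ for $a,j\in F$. Let $C\subseteq F^{n}$ be a linear MDS code of dimension $k$, i.e. with minimum distance $n-k+1$, and let $D\subseteq F^2$ be a linear MDS code of dimension $1$ (for instance $D=\{(\alpha,\alpha)\}$). Put $$|\phi_{n,0}\rangle=\sum_{c\in C}|c\rangle ,\qquad |\phi_{2,0}\rangle=\sum_{d\in D}|d\rangle ,\qquad |\phi_{n,2}\rangle=\bigl(\mathbb 1^{(n-2)}\otimes\mathcal O_2\bigr)|\phi_{n,0}\rangle ,$$ where $\mathcal O_2$ is the linear operator on the last two qudits given by $\mathcal O_2|i_1,i_2\rangle=(Z^{-i_1}\otimes X^{i_2})|\phi_{2,0}\rangle$. Then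 $|\phi_{n,0}\rangle$ and $|\phi_{n,2}\rangle$ are both absolutely maximally entangled (they are nonzero and all their reduced density matrices on at most $\lfloor n/2\rfloor=k$ qudits are proportional to the identity), and they are not SLOCC-equivalent: there are no invertible $q\times q$ complex matrices $M_1,\dots,M_n$ with $(M_1\otimes\cdots\otimes M_n)|\phi_{n,0}\rangle=|\phi_{n,2}\rangle$. -/

import Mathlib

open scoped BigOperators

noncomputable section

/-- Pure (unnormalized) states of `n` qudits whose computational basis is labelled by `F`
(so the local dimension is `q = |F|`): `ψ v` is the coefficient of `|v₁, …, vₙ⟩`. -/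
abbrev QState (F : Type*) (n : ℕ) : Type _ := (Fin n → F) → ℂ

/-- The action of `M₁ ⊗ ⋯ ⊗ Mₙ` on a state of `n` qudits. -/
def localAct {F : Type*} [Fintype F] {n : ℕ} (M : Fin n → Matrix F F ℂ) (ψ : QState F n) :
    QState F n :=
  fun v => ∑ w : Fin n → F, (∏ i, M i (v i) (w i)) * ψ w

/-- SLOCC equivalence: conversion by invertible local operators. A global scalar can be
absorbed in one of the factors as soon as `n ≥ 1`. -/
def SLOCCEquiv {F : Type*} [Fintype F] [DecidableEq F] {n : ℕ} (ψ φ : QState F n) : Prop :=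
  ∃ M : Fin n → Matrix F F ℂ, (∀ i, IsUnit (M i)) ∧ localAct M ψ = φ

/-- The reduced density matrix `ρ_S = Tr_{Sᶜ} |ψ⟩⟨ψ|` on the qudits in `S`. -/
def reducedDensity {F : Type*} [Fintype F] {n : ℕ} (ψ : QState F n) (S : Finset (Fin n)) :
    Matrix ({i // i ∈ S} → F) ({i // i ∈ S} → F) ℂ :=
  Matrix.of fun a b => ∑ w : {i // ¬ i ∈ S} → F,
    ψ ((Equiv.piEquivPiSubtypeProd (fun i => i ∈ S) (fun _ => F)).symm (a, w)) *
      starRingEnd ℂ (ψ ((Equiv.piEquivPiSubtypeProd (fun i => i ∈ S) (fun _ => F)).symm (b, w)))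

/-- `k`-uniform states: nonzero, and all reductions to at most `k` qudits are maximally mixed. -/
def IsKUniform {F : Type*} [Fintype F] [DecidableEq F] {n : ℕ} (k : ℕ) (ψ : QState F n) : Prop :=
  ψ ≠ 0 ∧ ∀ S : Finset (Fin n), S.card ≤ k → ∃ c : ℂ, reducedDensity ψ S = c • 1

/-- Absolutely maximally entangled states. -/
def IsAME {F : Type*} [Fintype F] [DecidableEq F] {n : ℕ} (ψ : QState F n) : Prop :=
  IsKUniform (n / 2) ψ

/-- `C` is a linear MDS code `[n, k, n - k + 1]` over `F`. -/
def IsMDSCode {F : Type*} [Field F] [DecidableEq F] {n : ℕ} (k : ℕ)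
    (C : Submodule F (Fin n → F)) : Prop :=
  Module.finrank F C = k ∧ ∀ c ∈ C, ∀ c' ∈ C, c ≠ c' → n + 1 ≤ hammingDist c c' + k

/-- The code state `|φ_{n,0}⟩ = ∑_{c ∈ C} |c⟩`. -/
def codeState {F : Type*} [Field F] {n : ℕ} (C : Submodule F (Fin n → F)) : QState F n :=
  Set.indicator (C : Set (Fin n → F)) (fun _ => 1)

/-- The generalized Pauli operator `X^a : |j⟩ ↦ |j + a⟩`. -/
def pauliX {F : Type*} [Field F] [DecidableEq F] (a : F) : Matrix F F ℂ :=
  Matrix.of fun i j => if i = j + a then 1 else 0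

/-- The generalized Pauli operator `Z^a : |j⟩ ↦ χ(a j) |j⟩`. For `F = ℤ/q` with `q` prime and
`χ j = exp (2 π i j / q)` this is the `a`-th power of the usual clock operator. -/
def pauliZ {F : Type*} [Field F] [DecidableEq F] (χ : AddChar F ℂ) (a : F) : Matrix F F ℂ :=
  Matrix.diagonal fun j => χ (a * j)

/-- The operator `𝒪` on `m` qudits, extended linearly from
`𝒪 |i₁, …, i_m⟩ = Z^{-i₁} ⊗ ⋯ ⊗ Z^{-i_κ} ⊗ X^{i_{κ+1}} ⊗ ⋯ ⊗ X^{i_m} |φ⟩`. -/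
def opO {F : Type*} [Field F] [Fintype F] [DecidableEq F] {m : ℕ} (χ : AddChar F ℂ) (κ : ℕ)
    (φ : QState F m) (ψ : QState F m) : QState F m :=
  fun v => ∑ i : Fin m → F, ψ i *
    localAct (fun j => if (j : ℕ) < κ then pauliZ χ (-(i j)) else pauliX (i j)) φ v

/-- `𝟙 ⊗ L`, where `L` acts on the last `m` of the `r + m` qudits. -/
def actLast {F : Type*} {r m : ℕ} (L : QState F m → QState F m) (ψ : QState F (r + m)) :
    QState F (r + m) :=
  fun v => L (fun w => ψ (Fin.append (fun i => v (Fin.castAdd m i)) w))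
    (fun j => v (Fin.natAdd r j))

/-- The state `|φ_{n,m}⟩ = (𝟙 ⊗ 𝒪) |φ_{n,0}⟩` of `n = r + m` qudits, where `|φ_{n,0}⟩` is the
code state of `C` and `𝒪` is built from the code state `|φ_{m,0}⟩` of a `κ`-dimensional
code `D`. -/
def hierState {F : Type*} [Field F] [Fintype F] [DecidableEq F] {r m : ℕ} (χ : AddChar F ℂ)
    (κ : ℕ) (C : Submodule F (Fin (r + m) → F)) (D : Submodule F (Fin m → F)) :
    QState F (r + m) :=
  actLast (opO χ κ (codeState D)) (codeState C)

end

/-! Let `l` be the slope of `D`. The support of the second state consists of the words `hierWord l c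
x`, each with coefficient a character value, so it is a linear space to translate by. For
uniformity, such translations keep moduli and make the diagonal of a reduced density matrix
constant; an off-diagonal entry is either an empty sum or equals itself times a phase other than 1
(`isKUniform_of_translations`).

For inequivalence, suppose `⨂ M` maps one state to the other. On any `k + 1` of the first `r`
qudits, the support of the target restricts to words of `C`, no two of which differ in exactly one
place. This forces the first `r` matrices to be monomial (`column_unique_of_localAct_eq_hierState`).
Setting those `r` qudits to 0 then selects a single codeword on the source side, leaving a product
state on the last two qudits, whereas the target leaves the entangled state of `D`. -/

open scoped ComplexConjugate

/-! ### MDS codes -/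

section Codes

variable {F : Type*} [Field F] [DecidableEq F] {n k : ℕ} {C : Submodule F (Fin n → F)}

theorem IsMDSCode.eq_zero_of_support (hC : IsMDSCode k C) {c : Fin n → F} (hc : c ∈ C)
    (T : Finset (Fin n)) (hT : ∀ i ∉ T, c i = 0) (hcard : T.card + k < n + 1) : c = 0 := by
  by_contra h
  have h1 := hC.2 c hc 0 C.zero_mem h
  have h2 : hammingDist c 0 ≤ T.card := by
    apply Finset.card_le_card
    intro i hi
    by_contra hiT
    simp [hT i hiT] at hi
  omega

theorem IsMDSCode.eq_of_eqOn (hC : IsMDSCode k C) {c d : Fin n → F} (hc : c ∈ C) (hd : d ∈ C)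
    (T : Finset (Fin n)) (hT : ∀ i ∉ T, c i = d i) (hcard : T.card + k < n + 1) : c = d :=
  sub_eq_zero.1 <| hC.eq_zero_of_support (C.sub_mem hc hd) T
    (fun i hi => by simp [hT i hi]) hcard

/-- Any `k` coordinates of an MDS code of dimension `k` can be prescribed. -/
theorem IsMDSCode.exists_eqOn (hC : IsMDSCode k C) (S : Finset (Fin n)) (hS : S.card ≤ k)
    (a : Fin n → F) : ∃ c ∈ C, ∀ i ∈ S, c i = a i := by
  have hkn : k ≤ n := by
    have := Submodule.finrank_le C
    rw [hC.1] at this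
    simpa using this
  obtain ⟨T, hST, hT⟩ := Finset.exists_superset_card_eq (s := S) hS (by simpa using hkn)
  -- A codeword vanishing on `k` coordinates has weight at most `n - k`, below the minimum distance,
  -- so restriction to `T` is bijective.
  let f : C →ₗ[F] (T → F) := (LinearMap.funLeft F F (fun i : T => (i : Fin n))).comp C.subtype
  have hf : Function.Injective f := by
    rw [← LinearMap.ker_eq_bot, LinearMap.ker_eq_bot']
    intro c hc
    apply Subtype.ext
    refine hC.eq_zero_of_support c.2 Tᶜ (fun i hi => ?_) ?_
    · exact congrFun hc ⟨i, by simpa using hi⟩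
    · rw [Finset.card_compl, Fintype.card_fin]
      omega
  have hfs : Function.Surjective f :=
    (LinearMap.injective_iff_surjective_of_finrank_eq_finrank (by simp [hC.1, hT])).1 hf
  obtain ⟨c, hc⟩ := hfs (fun i => a i)
  exact ⟨c, c.2, fun i hi => congrFun hc ⟨i, hST hi⟩⟩

theorem IsMDSCode.exists_slope {D : Submodule F (Fin 2 → F)} (hD : IsMDSCode 1 D) :
    ∃ l : F, l ≠ 0 ∧ ∀ d, d ∈ D ↔ d 1 = l * d 0 := by
  obtain ⟨e, heD, he⟩ := hD.exists_eqOn {0} (by simp) (fun _ => 1)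
  have he0 : e 0 = 1 := he 0 (by simp)
  have he1 : e 1 ≠ 0 := by
    intro h
    have : e = 0 := hD.eq_zero_of_support heD {0} (fun i hi => by
      fin_cases i
      · simp at hi
      · exact h) (by simp)
    simp [this] at he0
  refine ⟨e 1, he1, fun d => ⟨fun hd => ?_, fun hd => ?_⟩⟩
  · have : d = d 0 • e := hD.eq_of_eqOn hd (D.smul_mem _ heD) {1} (fun i hi => by
      fin_cases i
      · simp [he0]
      · simp at hi) (by simp)
    rw [mul_comm]
    exact congrFun this 1
  · have : d = d 0 • e := by
      ext i
      fin_cases i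
      · simp [he0]
      · simp [hd, mul_comm]
    rw [this]
    exact D.smul_mem _ heD

end Codes

/-! ### Local operators, uniformity and monomial matrices -/

section States

variable {F : Type*} [Fintype F] {n : ℕ}

theorem localAct_mul (N M : Fin n → Matrix F F ℂ) (ψ : QState F n) :
    localAct N (localAct M ψ) = localAct (fun i => N i * M i) ψ := by
  funext v
  simp only [localAct, Matrix.mul_apply, Finset.mul_sum]
  rw [Finset.sum_comm]
  refine Finset.sum_congr rfl fun w _ => ?_
  rw [Finset.prod_univ_sum, Fintype.piFinset_univ, Finset.sum_mul]
  refine Finset.sum_congr rfl fun u _ => ?_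
  rw [Finset.prod_mul_distrib, mul_assoc]

variable [DecidableEq F]

/-- A state is `k`-uniform if its modulus is invariant under enough translations and its
correlations are multiplied by a nontrivial phase under suitable ones. -/
theorem isKUniform_of_translations [AddCommGroup F] {k : ℕ} {ψ : QState F n} (hψ : ψ ≠ 0)
    (hdiag : ∀ S : Finset (Fin n), S.card ≤ k → ∀ a : Fin n → F, ∃ t : Fin n → F,
      (∀ i ∈ S, t i = a i) ∧ ∀ u, ψ (u + t) * conj (ψ (u + t)) = ψ u * conj (ψ u))
    (hoff : ∀ S : Finset (Fin n), S.card ≤ k → ∀ u v : Fin n → F, u ≠ v →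
      (∀ i ∉ S, u i = v i) → ψ u ≠ 0 → ψ v ≠ 0 → ∃ (t : Fin n → F) (z : ℂ), z ≠ 1 ∧
        (∀ i ∈ S, t i = 0) ∧ ∀ u' v', u' - v' = u - v →
          ψ (u' + t) * conj (ψ (v' + t)) = z * (ψ u' * conj (ψ v'))) :
    IsKUniform k ψ := by
  refine ⟨hψ, fun S hS => ⟨reducedDensity ψ S 0 0, ?_⟩⟩
  let g (a : {i // i ∈ S} → F) (w : {i // ¬ i ∈ S} → F) : Fin n → F :=
    (Equiv.piEquivPiSubtypeProd (fun i => i ∈ S) (fun _ => F)).symm (a, w)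
  have g_in (a w) (i : Fin n) (hi : i ∈ S) : g a w i = a ⟨i, hi⟩ := by
    simp [g, Equiv.piEquivPiSubtypeProd, hi]
  have g_out (a w) (i : Fin n) (hi : i ∉ S) : g a w i = w ⟨i, hi⟩ := by
    simp [g, Equiv.piEquivPiSubtypeProd, hi]
  have g_add (a w) (t : Fin n → F) :
      g a w + t = g (fun i => a i + t i) (fun i => w i + t i) := by
    funext i
    by_cases hi : i ∈ S
    · simp [g_in _ _ i hi]
    · simp [g_out _ _ i hi]
  have hρ (a b) : reducedDensity ψ S a b = ∑ w, ψ (g a w) * conj (ψ (g b w)) := rfl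
  have key (a b) (t : Fin n → F) : reducedDensity ψ S (fun i => a i + t i) (fun i => b i + t i) =
      ∑ w, ψ (g a w + t) * conj (ψ (g b w + t)) := by
    rw [hρ, ← Equiv.sum_comp (Equiv.addRight (fun i : {i // ¬ i ∈ S} => t i))]
    simp only [g_add]
    rfl
  ext a b
  rw [Matrix.smul_apply, Matrix.one_apply]
  split_ifs with hab
  · subst hab
    obtain ⟨t, hta, ht⟩ := hdiag S hS (g a 0)
    have ha : a = fun i => (0 : {i // i ∈ S} → F) i + t i := by
      funext i
      simp [hta i i.2, g_in]
    conv_lhs => rw [ha]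
    rw [key, hρ]
    simp [ht]
  · rw [smul_zero]
    by_contra hne
    rw [hρ] at hne
    obtain ⟨w, -, hw⟩ := Finset.exists_ne_zero_of_sum_ne_zero hne
    -- The difference does not depend on the traced-out part, so one translation gives every summand
    -- the same factor `z`.
    have hsub (w') : g a w' - g b w' = g a w - g b w := by
      funext i
      by_cases hi : i ∈ S
      · simp [g_in _ _ i hi]
      · simp [g_out _ _ i hi]
    obtain ⟨t, z, hz, ht0, ht⟩ := hoff S hS (g a w) (g b w)
      (fun h => hab <| funext fun i => by
        have := congrFun h i
        rwa [g_in _ _ _ i.2, g_in _ _ _ i.2] at this)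
      (fun i hi => by rw [g_out _ _ i hi, g_out _ _ i hi])
      (left_ne_zero_of_mul hw) (fun h => hw (by simp [h]))
    have h1 := key a b t
    simp only [fun w' => ht _ _ (hsub w'), ← Finset.mul_sum] at h1
    have ha : (fun i : {i // i ∈ S} => a i + t i) = a := funext fun i => by simp [ht0 i i.2]
    have hb : (fun i : {i // i ∈ S} => b i + t i) = b := funext fun i => by simp [ht0 i i.2]
    rw [ha, hb, hρ] at h1
    exact hz (mul_right_cancel₀ hne (by rw [one_mul]; exact h1.symm))

/-- If every column of an invertible matrix has at most one nonzero entry, so has every row. -/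
theorem Matrix.row_unique_of_column_unique {M : Matrix F F ℂ} (hM : IsUnit M)
    (hcol : ∀ a b b', M b a ≠ 0 → M b' a ≠ 0 → b = b') {b a a' : F} (h : M b a ≠ 0)
    (h' : M b a' ≠ 0) : a = a' := by
  by_contra hne
  have hinj := Matrix.mulVec_injective_of_isUnit hM
  -- Columns `a` and `a'` are both supported in row `b`, hence proportional.
  have h0 : M.mulVec (Pi.single a (M b a') - Pi.single a' (M b a)) = M.mulVec 0 := by
    funext c
    by_cases hc : c = b
    · subst hc
      simp [Matrix.mulVec_sub, mul_comm]
    · have h1 : M c a = 0 := by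
        by_contra h1
        exact hc (hcol a _ _ h1 h)
      have h2 : M c a' = 0 := by
        by_contra h2
        exact hc (hcol a' _ _ h2 h')
      simp [Matrix.mulVec_sub, h1, h2]
  have := congrFun (hinj h0) a
  simp [hne, h'] at this

theorem Matrix.exists_column_ne_zero {M : Matrix F F ℂ} (hM : IsUnit M) (a : F) :
    ∃ b, M b a ≠ 0 := by
  by_contra! h
  have h0 : M.mulVec (Pi.single a 1) = M.mulVec 0 := by
    funext c
    simp [h]
  have := congrFun (Matrix.mulVec_injective_of_isUnit hM h0) a
  simp at this

end States

/-! ### Code states -/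

section CodeState

variable {F : Type*} [Field F] {n k : ℕ} {C : Submodule F (Fin n → F)}

theorem codeState_of_mem {c : Fin n → F} (hc : c ∈ C) : codeState C c = 1 := by
  simp [codeState, hc]

theorem codeState_ne_zero_iff {c : Fin n → F} : codeState C c ≠ 0 ↔ c ∈ C := by
  simp [codeState]

theorem codeState_add {c t : Fin n → F} (ht : t ∈ C) :
    codeState C (c + t) = codeState C c := by
  by_cases h : c ∈ C
  · rw [codeState_of_mem h, codeState_of_mem (C.add_mem h ht)]
  · have h' : c + t ∉ C := by rwa [C.add_mem_iff_left ht]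
    rw [← codeState_ne_zero_iff, not_not] at h h'
    rw [h, h']

theorem IsMDSCode.isKUniform_codeState [Fintype F] [DecidableEq F] (hC : IsMDSCode k C)
    (hk : 2 * k < n + 1) : IsKUniform k (codeState C) := by
  refine isKUniform_of_translations
    (fun h => one_ne_zero ((codeState_of_mem C.zero_mem).symm.trans (congrFun h 0))) ?_ ?_
  · intro S hS a
    obtain ⟨c, hc, h⟩ := hC.exists_eqOn S hS a
    exact ⟨c, h, fun u => by rw [codeState_add hc]⟩
  · intro S hS u v huv h hu hv
    rw [codeState_ne_zero_iff] at hu hv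
    exact absurd (hC.eq_of_eqOn hu hv S h (by omega)) huv

/-- Let `⨂ M` map the code state to `φ`, and let the coordinates off `S` determine the codewords.
Then the images of the codewords restricted to `S` lie in the restriction to `S` of the
support of `φ`. -/
theorem exists_eqOn_of_localAct_codeState [Fintype F] [DecidableEq F]
    {M : Fin n → Matrix F F ℂ} (hM : ∀ i, IsUnit (M i)) {φ : QState F n}
    (hφ : localAct M (codeState C) = φ) (S : Finset (Fin n))
    (hS : ∀ c ∈ C, ∀ d ∈ C, (∀ i ∉ S, c i = d i) → c = d) {c : Fin n → F} (hc : c ∈ C)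
    {v : Fin n → F} (hv : ∀ i ∈ S, M i (v i) (c i) ≠ 0) :
    ∃ w, φ w ≠ 0 ∧ ∀ i ∈ S, w i = v i := by
  -- Undoing `M` off `S` and reading the entries of `c` there isolates `c`, so what remains on `S`
  -- is a product vector.
  let N : Fin n → Matrix F F ℂ := fun i => if i ∈ S then 1 else (M i)⁻¹
  let u : Fin n → F := fun i => if i ∈ S then v i else c i
  have h1 : localAct N φ u = ∏ i, (N i * M i) (u i) (c i) := by
    rw [← hφ, localAct_mul, localAct, Finset.sum_eq_single c]
    · rw [codeState_of_mem hc, mul_one]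
    · intro d _ hdc
      by_contra h
      have hd : d ∈ C := codeState_ne_zero_iff.1 (right_ne_zero_of_mul h)
      refine hdc (hS d hd c hc fun i hi => ?_)
      have h2 := Finset.prod_ne_zero_iff.1 (left_ne_zero_of_mul h) i (Finset.mem_univ i)
      simp only [N, u, hi, if_false] at h2
      rw [Matrix.nonsing_inv_mul _ ((Matrix.isUnit_iff_isUnit_det _).1 (hM i)),
        Matrix.one_apply] at h2
      by_contra h3
      exact h2 (if_neg (Ne.symm h3))
    · simp
  have h2 : localAct N φ u ≠ 0 := by
    rw [h1, Finset.prod_ne_zero_iff]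
    intro i _
    by_cases hi : i ∈ S
    · simpa [N, u, hi] using hv i hi
    · simp only [N, u, hi, if_false]
      rw [Matrix.nonsing_inv_mul _ ((Matrix.isUnit_iff_isUnit_det _).1 (hM i))]
      simp
  obtain ⟨w, -, hw⟩ := Finset.exists_ne_zero_of_sum_ne_zero h2
  refine ⟨w, right_ne_zero_of_mul hw, fun i hi => ?_⟩
  have h3 := Finset.prod_ne_zero_iff.1 (left_ne_zero_of_mul hw) i (Finset.mem_univ i)
  simp only [N, u, hi, if_true, Matrix.one_apply] at h3
  by_contra h4
  exact h3 (if_neg (Ne.symm h4))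

end CodeState

/-! ### Support and phases of the second state -/

section HierState

theorem eq_of_coords {F : Type*} {r : ℕ} {v w : Fin (r + 2) → F}
    (h : ∀ i : Fin r, v (Fin.castAdd 2 i) = w (Fin.castAdd 2 i))
    (h0 : v (Fin.natAdd r 0) = w (Fin.natAdd r 0))
    (h1 : v (Fin.natAdd r 1) = w (Fin.natAdd r 1)) : v = w := by
  funext j
  induction j using Fin.addCases with
  | left i => exact h i
  | right i =>
    fin_cases i
    · exact h0
    · exact h1

variable {F : Type*} [Field F] {r : ℕ}

/-- The word `(c₁, …, c_r, x, l x + c_{r+2})`. These words, for `c ∈ C` and `x ∈ F`, are the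
support of `|φ_{n,2}⟩`, where `l` is the slope of `D`. -/
def hierWord (l : F) (c : Fin (r + 2) → F) (x : F) : Fin (r + 2) → F :=
  Fin.append (fun i => c (Fin.castAdd 2 i)) ![x, l * x + c (Fin.natAdd r 1)]

variable {l : F}

@[simp] theorem hierWord_castAdd (c : Fin (r + 2) → F) (x : F) (i : Fin r) :
    hierWord l c x (Fin.castAdd 2 i) = c (Fin.castAdd 2 i) := by
  simp [hierWord]

@[simp] theorem hierWord_natAdd_zero (c : Fin (r + 2) → F) (x : F) :
    hierWord l c x (Fin.natAdd r 0) = x := by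
  rw [hierWord, Fin.append_right]
  rfl

@[simp] theorem hierWord_natAdd_one (c : Fin (r + 2) → F) (x : F) :
    hierWord l c x (Fin.natAdd r 1) = l * x + c (Fin.natAdd r 1) := by
  rw [hierWord, Fin.append_right]
  rfl

theorem hierWord_add (c d : Fin (r + 2) → F) (x y : F) :
    hierWord l (c + d) (x + y) = hierWord l c x + hierWord l d y := by
  apply eq_of_coords
  · simp
  · simp only [hierWord_natAdd_zero, Pi.add_apply]
  · simp only [hierWord_natAdd_one, Pi.add_apply]
    ring

theorem hierWord_sub (c d : Fin (r + 2) → F) (x y : F) :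
    hierWord l (c - d) (x - y) = hierWord l c x - hierWord l d y := by
  rw [eq_sub_iff_add_eq, ← hierWord_add, sub_add_cancel, sub_add_cancel]

theorem AddChar.mul_conj_self [Fintype F] (χ : AddChar F ℂ) (x : F) : χ x * conj (χ x) = 1 := by
  rw [← AddChar.map_neg_eq_conj, ← AddChar.map_add_eq_mul, add_neg_cancel,
    AddChar.map_zero_eq_one]

/-- A word of the support of `|φ_{n,2}⟩` of weight at most `k` comes from the zero codeword. -/
theorem IsMDSCode.eq_zero_of_hierWord [DecidableEq F] {k : ℕ}
    {C : Submodule F (Fin (r + 2) → F)} (hC : IsMDSCode k C) (hr : 2 * k ≤ r + 1)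
    {c : Fin (r + 2) → F} (hc : c ∈ C) {x : F} {S : Finset (Fin (r + 2))} (hS : S.card ≤ k)
    (h : ∀ i ∉ S, hierWord l c x i = 0) : c = 0 := by
  by_cases hlast : Fin.natAdd r 0 ∈ S ∨ Fin.natAdd r 1 ∈ S
  · refine hC.eq_zero_of_support hc (S ∪ {Fin.natAdd r 0, Fin.natAdd r 1}) (fun i hi => ?_) ?_
    · simp only [Finset.mem_union, Finset.mem_insert, Finset.mem_singleton, not_or] at hi
      obtain ⟨hiS, hi0, hi1⟩ := hi
      have := h i hiS
      induction i using Fin.addCases with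
      | left i => simpa using this
      | right i =>
        fin_cases i
        · exact absurd rfl hi0
        · exact absurd rfl hi1
    -- Since `S` already meets the last two positions, at most one is added.
    · have : (S ∪ {Fin.natAdd r 0, Fin.natAdd r 1}).card ≤ S.card + 1 := by
        rcases hlast with h0 | h0
        · rw [Finset.union_insert, Finset.insert_eq_of_mem (by simp [h0])]
          exact (Finset.card_union_le _ _).trans (by simp)
        · rw [Finset.pair_comm, Finset.union_insert, Finset.insert_eq_of_mem (by simp [h0])]
          exact (Finset.card_union_le _ _).trans (by simp)
      omega
  · rw [not_or] at hlast
    have hx := h _ hlast.1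
    have hx1 := h _ hlast.2
    rw [hierWord_natAdd_zero] at hx
    rw [hierWord_natAdd_one, hx, mul_zero, zero_add] at hx1
    refine hC.eq_zero_of_support hc (insert (Fin.natAdd r 0) S) (fun i hi => ?_) ?_
    · rw [Finset.mem_insert, not_or] at hi
      have := h i hi.2
      induction i using Fin.addCases with
      | left i => simpa using this
      | right i =>
        fin_cases i
        · exact absurd rfl hi.1
        · exact hx1
    · have := Finset.card_insert_le (Fin.natAdd r 0) S
      omega

variable [Fintype F] [DecidableEq F] {χ : AddChar F ℂ} {C : Submodule F (Fin (r + 2) → F)}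
  {D : Submodule F (Fin 2 → F)}

/-- The `Z` factor is diagonal and the `X` factor a shift, so only the word of `D` with first entry
`a` contributes; this fixes the second input index and leaves the first, `x`, free. -/
theorem hierState_apply (hl : ∀ d, d ∈ D ↔ d 1 = l * d 0) (v : Fin (r + 2) → F) :
    hierState χ 1 C D v = ∑ x : F,
      codeState C (Fin.append (fun i => v (Fin.castAdd 2 i))
        ![x, v (Fin.natAdd r 1) - l * v (Fin.natAdd r 0)]) * χ (-x * v (Fin.natAdd r 0)) := by
  set a := v (Fin.natAdd r 0)
  set b := v (Fin.natAdd r 1)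
  have inner (i : Fin 2 → F) : localAct (fun j : Fin 2 => if (j : ℕ) < 1 then pauliZ χ (-(i j))
      else pauliX (i j)) (codeState D) (fun j => v (Fin.natAdd r j)) =
      if i 1 = b - l * a then χ (-(i 0) * a) else 0 := by
    rw [localAct, Finset.sum_eq_single ![a, b - i 1]]
    · have hmem : ![a, b - i 1] ∈ D ↔ i 1 = b - l * a := by
        rw [hl]
        simp only [Matrix.cons_val_zero, Matrix.cons_val_one]
        constructor <;> intro h <;> linear_combination -h
      by_cases h : i 1 = b - l * a
      · rw [if_pos h, codeState_of_mem (hmem.2 h)]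
        simp [Fin.prod_univ_two, pauliZ, pauliX, a, b]
      · rw [if_neg h]
        have h' : ¬ codeState D ![a, b - i 1] ≠ 0 := by rwa [codeState_ne_zero_iff, hmem]
        rw [not_not.1 h', mul_zero]
    · intro w _ hw
      by_contra h
      have h' := left_ne_zero_of_mul h
      rw [Fin.prod_univ_two] at h'
      have h0 := left_ne_zero_of_mul h'
      have h1 := right_ne_zero_of_mul h'
      simp [pauliZ, pauliX, Matrix.diagonal_apply] at h0 h1
      apply hw
      funext j
      fin_cases j
      · exact h0.1.symm
      · exact eq_sub_of_add_eq h1.symm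
    · simp
  rw [hierState, actLast, opO]
  simp only [inner]
  rw [← (finTwoArrowEquiv F).symm.sum_comp, Fintype.sum_prod_type]
  refine Finset.sum_congr rfl fun x _ => ?_
  rw [Finset.sum_eq_single (b - l * a)]
  · simp [finTwoArrowEquiv]
  · intro y _ hy
    simp [finTwoArrowEquiv, hy]
  · simp

theorem exists_hierWord_of_hierState_ne_zero (hl : ∀ d, d ∈ D ↔ d 1 = l * d 0)
    {v : Fin (r + 2) → F} (hv : hierState χ 1 C D v ≠ 0) :
    ∃ c ∈ C, v = hierWord l c (v (Fin.natAdd r 0)) := by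
  rw [hierState_apply hl] at hv
  obtain ⟨x, -, hx⟩ := Finset.exists_ne_zero_of_sum_ne_zero hv
  refine ⟨_, codeState_ne_zero_iff.1 (left_ne_zero_of_mul hx), ?_⟩
  apply eq_of_coords
  · intro i
    simp
  · rw [hierWord_natAdd_zero]
  · rw [hierWord_natAdd_one, Fin.append_right]
    simp

variable {k : ℕ}

theorem hierState_hierWord (hl : ∀ d, d ∈ D ↔ d 1 = l * d 0) (hC : IsMDSCode k C)
    (hk : k ≤ r + 1) {c : Fin (r + 2) → F} (hc : c ∈ C) (x : F) :
    hierState χ 1 C D (hierWord l c x) = χ (-(c (Fin.natAdd r 0)) * x) := by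
  rw [hierState_apply hl]
  simp only [hierWord_castAdd, hierWord_natAdd_zero, hierWord_natAdd_one, add_sub_cancel_left]
  -- Codewords that differ in at most one coordinate coincide.
  rw [Finset.sum_eq_single (c (Fin.natAdd r 0))]
  · have : Fin.append (fun i => c (Fin.castAdd 2 i))
        ![c (Fin.natAdd r 0), c (Fin.natAdd r 1)] = c := by
      apply eq_of_coords
      · simp
      · rw [Fin.append_right]; rfl
      · rw [Fin.append_right]; rfl
    rw [this, codeState_of_mem hc, one_mul]
  · intro y _ hy
    by_contra h
    have hm := codeState_ne_zero_iff.1 (left_ne_zero_of_mul h)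
    have := hC.eq_of_eqOn hm hc {Fin.natAdd r 0} (fun i hi => by
      induction i using Fin.addCases with
      | left i => simp
      | right i =>
        fin_cases i
        · simp at hi
        · rw [Fin.append_right]; rfl) (by simp; omega)
    have h0 := congrFun this (Fin.natAdd r 0)
    rw [Fin.append_right] at h0
    exact hy h0
  · simp

theorem hierState_add_hierWord_ne_zero_iff (hl : ∀ d, d ∈ D ↔ d 1 = l * d 0)
    (hC : IsMDSCode k C) (hk : k ≤ r + 1) {e : Fin (r + 2) → F} (he : e ∈ C) (y : F)
    (u : Fin (r + 2) → F) :
    hierState χ 1 C D (u + hierWord l e y) ≠ 0 ↔ hierState χ 1 C D u ≠ 0 := by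
  have supp {c : Fin (r + 2) → F} (hc : c ∈ C) (x : F) :
      hierState χ 1 C D (hierWord l c x) ≠ 0 := by
    rw [hierState_hierWord hl hC hk hc]
    exact (AddChar.val_isUnit χ _).ne_zero
  constructor
  · intro h
    obtain ⟨c, hc, h⟩ := exists_hierWord_of_hierState_ne_zero hl h
    rw [eq_sub_of_add_eq h, ← hierWord_sub]
    exact supp (C.sub_mem hc he) _
  · intro h
    obtain ⟨c, hc, h⟩ := exists_hierWord_of_hierState_ne_zero hl h
    rw [h, ← hierWord_add]
    exact supp (C.add_mem hc he) _

theorem hierState_add_mul_conj (hl : ∀ d, d ∈ D ↔ d 1 = l * d 0) (hC : IsMDSCode k C)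
    (hk : k ≤ r + 1) {e : Fin (r + 2) → F} (he : e ∈ C) (y : F) (u : Fin (r + 2) → F) :
    hierState χ 1 C D (u + hierWord l e y) * conj (hierState χ 1 C D (u + hierWord l e y)) =
      hierState χ 1 C D u * conj (hierState χ 1 C D u) := by
  have h := hierState_add_hierWord_ne_zero_iff (χ := χ) hl hC hk he y u
  by_cases hu : hierState χ 1 C D u = 0
  · rw [hu, not_ne_iff.1 fun h' => h.1 h' hu]
  · obtain ⟨c, hc, hu⟩ := exists_hierWord_of_hierState_ne_zero hl hu
    rw [hu, ← hierWord_add, hierState_hierWord hl hC hk hc,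
      hierState_hierWord hl hC hk (C.add_mem hc he), AddChar.mul_conj_self,
      AddChar.mul_conj_self]

/-- The exponent of the coefficient is bilinear in `c` and `x`. This supplies the phase that kills
off-diagonal entries. -/
theorem hierState_add_hierWord_zero (hl : ∀ d, d ∈ D ↔ d 1 = l * d 0) (hC : IsMDSCode k C)
    (hk : k ≤ r + 1) {e : Fin (r + 2) → F} (he : e ∈ C) (u : Fin (r + 2) → F) :
    hierState χ 1 C D (u + hierWord l e 0) =
      χ (-(e (Fin.natAdd r 0)) * u (Fin.natAdd r 0)) * hierState χ 1 C D u := by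
  have h := hierState_add_hierWord_ne_zero_iff (χ := χ) hl hC hk he 0 u
  by_cases hu : hierState χ 1 C D u = 0
  · rw [hu, not_ne_iff.1 fun h' => h.1 h' hu, mul_zero]
  · obtain ⟨c, hc, hu⟩ := exists_hierWord_of_hierState_ne_zero hl hu
    generalize u (Fin.natAdd r 0) = x at hu
    subst hu
    rw [← hierWord_add, hierState_hierWord hl hC hk hc,
      hierState_hierWord hl hC hk (C.add_mem hc he), ← AddChar.map_add_eq_mul]
    congr 1
    simp only [Pi.add_apply]
    ring

/-! ### Uniformity of the second state -/

theorem isKUniform_hierState (hχ : χ ≠ 1) (hl0 : l ≠ 0) (hl : ∀ d, d ∈ D ↔ d 1 = l * d 0)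
    (hC : IsMDSCode k C) (hr : 2 * k ≤ r + 1) : IsKUniform k (hierState χ 1 C D) := by
  have hk : k ≤ r + 1 := by omega
  refine isKUniform_of_translations ?_ ?_ ?_
  · intro h
    have h1 := hierState_hierWord (χ := χ) hl hC hk C.zero_mem 0
    rw [h] at h1
    simp at h1
  · intro S hS a
    -- The last entry is corrected in advance for the `l * x` that `hierWord` adds.
    obtain ⟨c, hc, h⟩ := hC.exists_eqOn S hS (Function.update a (Fin.natAdd r 1)
      (a (Fin.natAdd r 1) - l * a (Fin.natAdd r 0)))
    refine ⟨hierWord l c (a (Fin.natAdd r 0)), fun i hi => ?_,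
      hierState_add_mul_conj hl hC hk hc _⟩
    have hci := h i hi
    induction i using Fin.addCases with
    | left i =>
      rw [hierWord_castAdd, hci, Function.update_of_ne]
      intro h
      have := congrArg Fin.val h
      simp at this
      omega
    | right i =>
      fin_cases i
      · exact hierWord_natAdd_zero _ _
      · refine (hierWord_natAdd_one _ _).trans ?_
        have hci' : c (Fin.natAdd r 1) = a (Fin.natAdd r 1) - l * a (Fin.natAdd r 0) :=
          hci.trans (Function.update_self _ _ _)
        rw [hci']
        exact add_sub_cancel _ _
  · intro S hS u v huv h hu hv
    obtain ⟨c, hc, hcu⟩ := exists_hierWord_of_hierState_ne_zero hl hu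
    obtain ⟨d, hd, hdv⟩ := exists_hierWord_of_hierState_ne_zero hl hv
    generalize u (Fin.natAdd r 0) = x at hcu
    generalize v (Fin.natAdd r 0) = y at hdv
    have huv' : u - v = hierWord l (c - d) (x - y) := by rw [hierWord_sub, hcu, hdv]
    have hδ : ∀ i ∉ S, hierWord l (c - d) (x - y) i = 0 := by
      intro i hi
      rw [← huv']
      simp [h i hi]
    have hcd := hC.eq_zero_of_hierWord hr (C.sub_mem hc hd) hS hδ
    rw [hcd] at hδ huv'
    have hxy : x - y ≠ 0 := by
      intro h0
      rw [h0] at huv'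
      apply huv
      rw [← sub_eq_zero, huv']
      apply eq_of_coords
      · simp
      · simp only [hierWord_natAdd_zero, Pi.zero_apply]
      · simp only [hierWord_natAdd_one, Pi.zero_apply, mul_zero, add_zero]
    have h0S : Fin.natAdd r 0 ∈ S := by
      by_contra hn
      have := hδ _ hn
      rw [hierWord_natAdd_zero] at this
      exact hxy this
    have h1S : Fin.natAdd r 1 ∈ S := by
      by_contra hn
      have := hδ _ hn
      rw [hierWord_natAdd_one, Pi.zero_apply, add_zero] at this
      exact mul_ne_zero hl0 hxy this
    obtain ⟨s, hs⟩ := (AddChar.ne_one_iff).1 hχ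
    -- The two words differ by `(0, …, 0, x - y, l (x - y))`. This `e` makes the relative phase `χ
    -- s`, while `hierWord l e 0` vanishes on `S`.
    obtain ⟨e, he, heS⟩ := hC.exists_eqOn S hS (Pi.single (Fin.natAdd r 0) (-s / (x - y)))
    have he0 : e (Fin.natAdd r 0) = -s / (x - y) := by rw [heS _ h0S, Pi.single_eq_same]
    have hes (i) (hi : i ∈ S) (hne : i ≠ Fin.natAdd r 0) : e i = 0 := by
      rw [heS i hi, Pi.single_eq_of_ne hne]
    refine ⟨hierWord l e 0, χ s, hs, fun i hi => ?_, fun u' v' huv'' => ?_⟩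
    · induction i using Fin.addCases with
      | left i =>
        rw [hierWord_castAdd]
        refine hes _ hi fun h => ?_
        have := congrArg Fin.val h
        simp at this
        omega
      | right i =>
        fin_cases i
        · exact hierWord_natAdd_zero _ _
        · refine (hierWord_natAdd_one _ _).trans ?_
          rw [mul_zero, zero_add]
          refine hes _ h1S fun h => ?_
          have := congrArg Fin.val h
          simp at this
    · rw [hierState_add_hierWord_zero hl hC hk he, hierState_add_hierWord_zero hl hC hk he,
        map_mul (starRingEnd ℂ), mul_mul_mul_comm, ← AddChar.map_neg_eq_conj, ← AddChar.map_add_eq_mul]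
      congr 2
      have h3 := congrFun (huv''.trans huv') (Fin.natAdd r 0)
      rw [hierWord_natAdd_zero, Pi.sub_apply] at h3
      rw [he0]
      field_simp
      linear_combination s * h3

/-! ### SLOCC inequivalence -/

/-- An invertible local operator from the code state to `|φ_{n,2}⟩` is monomial on the first `r`
qudits. -/
theorem column_unique_of_localAct_eq_hierState (hl : ∀ d, d ∈ D ↔ d 1 = l * d 0)
    (hC : IsMDSCode k C) (hk : 2 ≤ k) (hr : r + 2 = 2 * k + 1)
    {M : Fin (r + 2) → Matrix F F ℂ} (hM : ∀ i, IsUnit (M i))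
    (hφ : localAct M (codeState C) = hierState χ 1 C D) (j : Fin r) (a b b' : F)
    (hb : M (Fin.castAdd 2 j) b a ≠ 0) (hb' : M (Fin.castAdd 2 j) b' a ≠ 0) : b = b' := by
  -- There is room for `k + 1` positions among the first `r = 2 k - 1` because `k ≥ 2`.
  obtain ⟨S₀, hjS₀, hS₀⟩ := Finset.exists_superset_card_eq (s := {j}) (n := k + 1)
    (by simp) (by simp; omega)
  let S : Finset (Fin (r + 2)) := S₀.map (Fin.castAddEmb 2)
  have hS : S.card = k + 1 := by simp [S, hS₀]
  have hjS : Fin.castAdd 2 j ∈ S :=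
    Finset.mem_map_of_mem (Fin.castAddEmb 2) (hjS₀ (Finset.mem_singleton_self j))
  obtain ⟨c, hc, hcj⟩ := hC.exists_eqOn {Fin.castAdd 2 j} (by simp; omega) (fun _ => a)
  have hcj := hcj _ (Finset.mem_singleton_self _)
  choose v hv using fun i => Matrix.exists_column_ne_zero (hM i) (c i)
  have lift (b : F) (hb : M (Fin.castAdd 2 j) b a ≠ 0) :
      ∃ d ∈ C, ∀ i ∈ S, d i = Function.update v (Fin.castAdd 2 j) b i := by
    obtain ⟨w, hw, hwS⟩ := exists_eqOn_of_localAct_codeState hM hφ S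
      (fun c hc d hd h => hC.eq_of_eqOn hc hd S h (by omega)) hc
      (v := Function.update v (Fin.castAdd 2 j) b) (fun i _ => by
        by_cases hi : i = Fin.castAdd 2 j
        · subst hi
          rwa [Function.update_self, hcj]
        · rw [Function.update_of_ne hi]
          exact hv i)
    obtain ⟨d, hd, hwd⟩ := exists_hierWord_of_hierState_ne_zero hl hw
    refine ⟨d, hd, fun i hi => ?_⟩
    rw [← hwS i hi, hwd]
    obtain ⟨i, -, rfl⟩ := Finset.mem_map.1 hi
    exact (hierWord_castAdd _ _ _).symm
  obtain ⟨d, hd, hdS⟩ := lift b hb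
  obtain ⟨d', hd', hdS'⟩ := lift b' hb'
  -- Both agree on the `k` positions of `S` other than `j`.
  have hdd : d = d' := by
    refine hC.eq_of_eqOn hd hd' (insert (Fin.castAdd 2 j) Sᶜ) (fun i hi => ?_) ?_
    · rw [Finset.mem_insert, not_or, Finset.mem_compl, not_not] at hi
      rw [hdS i hi.2, hdS' i hi.2, Function.update_of_ne hi.1, Function.update_of_ne hi.1]
    · have := Finset.card_insert_le (Fin.castAdd 2 j) Sᶜ
      rw [Finset.card_compl, Fintype.card_fin, hS] at this
      omega
  have h1 := hdS _ hjS
  have h2 := hdS' _ hjS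
  rw [Function.update_self] at h1 h2
  rw [← h1, ← h2, hdd]

theorem not_sloccEquiv_hierState (hl0 : l ≠ 0) (hl : ∀ d, d ∈ D ↔ d 1 = l * d 0)
    (hC : IsMDSCode k C) (hk : 2 ≤ k) (hr : r + 2 = 2 * k + 1) :
    ¬ SLOCCEquiv (codeState C) (hierState χ 1 C D) := by
  rintro ⟨M, hM, hφ⟩
  have hrow (j : Fin r) {b a a' : F} (h : M (Fin.castAdd 2 j) b a ≠ 0)
      (h' : M (Fin.castAdd 2 j) b a' ≠ 0) : a = a' :=
    Matrix.row_unique_of_column_unique (hM _)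
      (column_unique_of_localAct_eq_hierState hl hC hk hr hM hφ j) h h'
  have hdet {c d : Fin (r + 2) → F} (hc : c ∈ C) (hd : d ∈ C)
      (h : ∀ i : Fin r, c (Fin.castAdd 2 i) = d (Fin.castAdd 2 i)) : c = d := by
    refine hC.eq_of_eqOn hc hd {Fin.natAdd r 0, Fin.natAdd r 1} (fun i hi => ?_) ?_
    · induction i using Fin.addCases with
      | left i => exact h i
      | right i => fin_cases i <;> simp at hi
    · have := Finset.card_le_two (a := Fin.natAdd r (0 : Fin 2)) (b := Fin.natAdd r 1)
      omega
  let p (x y : F) : Fin (r + 2) → F := Fin.append (fun _ => 0) ![x, y]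
  have hp (x : F) : p x (l * x) = hierWord l 0 x := by simp [p, hierWord]
  have hp1 (x : F) : hierState χ 1 C D (p x (l * x)) = 1 := by
    rw [hp, hierState_hierWord hl hC (by omega) C.zero_mem]
    simp
  have hp0 : hierState χ 1 C D (p 0 l) = 0 := by
    by_contra h
    obtain ⟨c, hc, h⟩ := exists_hierWord_of_hierState_ne_zero hl h
    have h0 : p 0 l (Fin.natAdd r 0) = 0 := by simp only [p, Fin.append_right]; rfl
    have h1 : p 0 l (Fin.natAdd r 1) = l := by simp only [p, Fin.append_right]; rfl
    have hc0 : c = 0 := hdet hc C.zero_mem fun i => by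
      have := congrFun h (Fin.castAdd 2 i)
      rw [hierWord_castAdd] at this
      simp [← this, p]
    have := congrFun h (Fin.natAdd r 1)
    rw [hierWord_natAdd_one, h0, h1, hc0] at this
    exact hl0 (by simpa using this)
  have hterm (x y : F) (c : Fin (r + 2) → F) : ∏ i, M i (p x y i) (c i) =
      (∏ i : Fin r, M (Fin.castAdd 2 i) 0 (c (Fin.castAdd 2 i))) *
        (M (Fin.natAdd r 0) x (c (Fin.natAdd r 0)) * M (Fin.natAdd r 1) y (c (Fin.natAdd r 1))) := by
    rw [Fin.prod_univ_add, Fin.prod_univ_two]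
    simp only [p, Fin.append_left, Fin.append_right]
    rfl
  have hsum (x y : F) : hierState χ 1 C D (p x y) =
      ∑ c, (∏ i, M i (p x y i) (c i)) * codeState C c := by
    rw [← hφ]
    rfl
  have h00 := hp1 0
  obtain ⟨c, -, hc⟩ := Finset.exists_ne_zero_of_sum_ne_zero
    (((hsum _ _).symm.trans h00).trans_ne one_ne_zero)
  have hcC := codeState_ne_zero_iff.1 (right_ne_zero_of_mul hc)
  have hcM := left_ne_zero_of_mul hc
  rw [hterm] at hcM
  have hcr := fun i : Fin r =>
    Finset.prod_ne_zero_iff.1 (left_ne_zero_of_mul hcM) i (Finset.mem_univ i)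
  -- A monomial row lets only one symbol reach 0 at each of the first `r` positions, and these
  -- symbols determine the codeword.
  have hprod (x y : F) : hierState χ 1 C D (p x y) =
      (∏ i : Fin r, M (Fin.castAdd 2 i) 0 (c (Fin.castAdd 2 i))) *
        (M (Fin.natAdd r 0) x (c (Fin.natAdd r 0)) *
          M (Fin.natAdd r 1) y (c (Fin.natAdd r 1))) := by
    rw [hsum, Finset.sum_eq_single c]
    · rw [hterm, codeState_of_mem hcC, mul_one]
    · intro d _ hdc
      by_contra h
      have hdC := codeState_ne_zero_iff.1 (right_ne_zero_of_mul h)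
      have hdM := left_ne_zero_of_mul h
      rw [hterm] at hdM
      exact hdc (hdet hdC hcC fun i => hrow i
        (Finset.prod_ne_zero_iff.1 (left_ne_zero_of_mul hdM) i (Finset.mem_univ i)) (hcr i))
    · simp
  -- In a product, nonzero values at `(0, 0)` and `(1, l)` force one at `(0, l)`, contradicting
  -- `hp0`.
  have h11 := hp1 1
  rw [mul_one] at h11
  rw [hprod] at hp0 h11
  have hne := h11.trans_ne one_ne_zero
  exact mul_ne_zero (left_ne_zero_of_mul hcM) (mul_ne_zero
    (left_ne_zero_of_mul (right_ne_zero_of_mul hcM))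
    (right_ne_zero_of_mul (right_ne_zero_of_mul hne))) hp0

end HierState

/-- Here `n = r + 2 = 2 k + 1` is the number of qudits, `C` the MDS code defining `|φ_{n,0}⟩` and
`D` the MDS code of length two defining `|φ_{2,0}⟩`, for instance the repetition code. -/
theorem proposition3 {F : Type*} [Field F] [Fintype F] [DecidableEq F]
    (χ : AddChar F ℂ) (hχ : χ ≠ 1) (k r : ℕ) (hk : 2 ≤ k) (hr : r + 2 = 2 * k + 1)
    (C : Submodule F (Fin (r + 2) → F)) (hC : IsMDSCode k C)
    (D : Submodule F (Fin 2 → F)) (hD : IsMDSCode 1 D) :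
    IsAME (codeState C) ∧ IsAME (hierState χ 1 C D) ∧
      ¬ SLOCCEquiv (codeState C) (hierState χ 1 C D) := by
  obtain ⟨l, hl0, hl⟩ := hD.exists_slope
  have hhalf : (r + 2) / 2 = k := by omega
  refine ⟨?_, ?_, not_sloccEquiv_hierState hl0 hl hC hk hr⟩
  · rw [IsAME, hhalf]
    exact hC.isKUniform_codeState (by omega)
  · rw [IsAME, hhalf]
    exact isKUniform_hierState hχ hl0 hl hC (by omega)
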